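/- For $0\le a$ and $n\ge 0$ let $\mathrm{HAM}_n^{(=a)}:\{0,1\}^n\times\{0,1\}^n\to\{0,1\}$ be the function with $\mathrm{HAM}_n^{(=a)}(x,y)=1$ if and only if $x$ and $y$ differ in exactly $a$ coordinates. For a function $f:\{0,1\}^n\times\{0,1\}^n\to\{0,1\}$, where Alice holds $x$ and Bob holds $y$, let - $D(f)$ be the least worst-case number of bits sent in a deterministic two-party protocol (decision tree) at the end of which both parties know $f(x,y)$; - $Q^*(f)$ be the least number of qubits sent in a quantum protocol over a quantum channel, in which Alice and Bob initially share an arbitrary number of EPR pairs, and at the end of which both parties output $f(x,y)$ with probability $1$; - $C^*(f)$ be the least worst-case number of classical bits sent in a protocol with local quantum operations over a classical channel, in which Alice and Bob initially share an arbitrary number of EPR pairs, and at the end of which both parties output $f(x,y)$ with probability $1$. Then there is an absolute constant $c>0$ such that for all integers $n,a\ge 0$ with $a\le c\sqrt n$: 1. $D(\mathrm{HAM}_n^{(=a)})\ge n$; 2. $Q^*(\mathrm{HAM}_n^{(=a)})\ge n/2$; 3. $C^*(\mathrm{HAM}_n^{(=a)})\ge n$. Moreover, let $0\le a\le n$ be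 arbitrary, let $M$ be the $2^n\times 2^n$ real matrix with entries $M_{x,y}=\mathrm{HAM}_n^{(=a)}(x,y)$, and for $0\le m\le n$ put $$f(a,n,m)=\sum_{k=\max\{0,a+m-n\}}^{\min\{a,m\}}\binom{m}{k}\binom{n-m}{a-k}(-1)^k .$$ For every $z\in\{0,1\}^n$ with exactly $m$ ones, the vector $v_z$ with entries $v_z(x)=(-1)^{\sum_i x_iz_i}$ is an eigenvector of $M$ with eigenvalue $f(a,n,m)$; the eigenvalues of $M$ are exactly the numbers $f(a,n,m)$, $0\le m\le n$; and $f(a,n,m)=0$ for at most $a$ values $m\in\{0,\dots,n\}$. -/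

import Mathlib

open scoped ComplexOrder ENNReal

namespace HamComm

noncomputable section

/-- Bit strings of length `n`. -/
abbrev Bits (n : ℕ) : Type := Fin n → Bool

/-- The function with value `1` exactly on the pairs of strings that differ in exactly `a` bits. -/
def hamEq (n a : ℕ) (x y : Bits n) : Bool := decide (hammingDist x y = a)

/-! ### Deterministic protocols -/

/-- Deterministic two-party protocols (decision trees). At an inner node the party whose turn it is
sends one bit that depends on its input (and on the node, that is, on the bits sent so far);
at a leaf each party announces a value that depends on its input and on the leaf. -/
inductive DProtocol (X Y : Type) : Type
  | output (u : X → Bool) (v : Y → Bool) : DProtocol X Y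
  | aliceSends (msg : X → Bool) (next : Bool → DProtocol X Y) : DProtocol X Y
  | bobSends (msg : Y → Bool) (next : Bool → DProtocol X Y) : DProtocol X Y

namespace DProtocol

/-- The number of bits sent in the worst case (the depth of the tree). -/
def cost {X Y : Type} : DProtocol X Y → ℕ
  | output _ _ => 0
  | aliceSends _ next => 1 + max (next false).cost (next true).cost
  | bobSends _ next => 1 + max (next false).cost (next true).cost

/-- The values announced by Alice and by Bob. -/
def run {X Y : Type} : DProtocol X Y → X → Y → Bool × Bool
  | output u v, x, y => (u x, v y)
  | aliceSends msg next, x, y => (next (msg x)).run x y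
  | bobSends msg next, x, y => (next (msg y)).run x y

/-- At the end both parties know `f x y`. -/
def Computes {X Y : Type} (P : DProtocol X Y) (f : X → Y → Bool) : Prop :=
  ∀ x y, P.run x y = (f x y, f x y)

end DProtocol

/-- `D(f)`: the number of bits sent by an optimal deterministic protocol for `f`
(`⊤` if there is no protocol). -/
def D {X Y : Type} (f : X → Y → Bool) : ℕ∞ :=
  ⨅ (P : DProtocol X Y) (_ : P.Computes f), (P.cost : ℕ∞)

/-! ### Quantum ingredients

A joint pure state of Alice's register `ℂ^p` and Bob's register `ℂ^q` is given by its `p × q` matrix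
`ψ` of amplitudes: `∑ i j, ψ i j |i⟩|j⟩`. An operator `K` on Alice's side sends `ψ` to `K * ψ`,
an operator `L` on Bob's side sends it to `ψ * Lᵀ`. -/

/-- The state of `k` shared EPR pairs: `2^(-k/2) ∑ i, |i⟩|i⟩`, with `i` running over the `2^k`
basis states of `k` qubits. -/
def eprState (k : ℕ) : Matrix (Fin (2 ^ k)) (Fin (2 ^ k)) ℂ :=
  ((1 / Real.sqrt (2 ^ k) : ℝ) : ℂ) • (1 : Matrix (Fin (2 ^ k)) (Fin (2 ^ k)) ℂ)

/-- A two-outcome quantum measurement (positive operator valued measure). -/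
def IsPOVM {p : ℕ} (E : Bool → Matrix (Fin p) (Fin p) ℂ) : Prop :=
  (∀ v, (E v).PosSemidef) ∧ E false + E true = 1

/-- The map `|φ⟩ ↦ K false |φ⟩ ⊗ |0⟩ + K true |φ⟩ ⊗ |1⟩` is an isometry from `ℂ^p` to
`ℂ^p' ⊗ ℂ²`; equivalently, `K false`, `K true` are the Kraus operators of a measurement. -/
def IsIsometryPair {p p' : ℕ} (K : Bool → Matrix (Fin p') (Fin p) ℂ) : Prop :=
  (K false).conjTranspose * K false + (K true).conjTranspose * K true = 1

/-- The probability `⟨ψ|E ⊗ F|ψ⟩` of the joint outcome of two local measurements with respective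
POVM elements `E` (Alice) and `F` (Bob). -/
def outcomeProb {p q : ℕ} (E : Matrix (Fin p) (Fin p) ℂ) (F : Matrix (Fin q) (Fin q) ℂ)
    (ψ : Matrix (Fin p) (Fin q) ℂ) : ℝ :=
  (Matrix.trace (ψ.conjTranspose * (E * ψ * F.transpose))).re

/-! ### Quantum protocols with a classical channel -/

/-- Protocols with quantum registers `ℂ^p` (Alice) and `ℂ^q` (Bob) and a classical channel. At an
inner node a party performs a measurement on its register, chosen according to its input and to the
bits sent so far, and sends the outcome, one classical bit. The register may change its
dimension, so that ancillas, local unitaries and local noise are all covered.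
At a leaf each party measures its register and announces the outcome. -/
inductive CProtocol (X Y : Type) : ℕ → ℕ → Type
  | output {p q : ℕ} (E : X → Bool → Matrix (Fin p) (Fin p) ℂ)
      (F : Y → Bool → Matrix (Fin q) (Fin q) ℂ)
      (hE : ∀ x, IsPOVM (E x)) (hF : ∀ y, IsPOVM (F y)) : CProtocol X Y p q
  | aliceSends {p q : ℕ} (p' : ℕ) (K : X → Bool → Matrix (Fin p') (Fin p) ℂ)
      (hK : ∀ x, IsIsometryPair (K x)) (next : Bool → CProtocol X Y p' q) : CProtocol X Y p q
  | bobSends {p q : ℕ} (q' : ℕ) (L : Y → Bool → Matrix (Fin q') (Fin q) ℂ)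
      (hL : ∀ y, IsIsometryPair (L y)) (next : Bool → CProtocol X Y p q') : CProtocol X Y p q

namespace CProtocol

/-- The number of classical bits sent in the worst case. -/
def cost {X Y : Type} {p q : ℕ} : CProtocol X Y p q → ℕ
  | output _ _ _ _ => 0
  | aliceSends _ _ _ next => 1 + max (next false).cost (next true).cost
  | bobSends _ _ _ next => 1 + max (next false).cost (next true).cost

/-- The probability that both parties announce `v`, on inputs `x`, `y` and initial state `ψ`.
States after a measurement are not normalized: their squared norm is the probability of the
outcomes that led to them. -/
def prob {X Y : Type} {p q : ℕ} :
    CProtocol X Y p q → Matrix (Fin p) (Fin q) ℂ → X → Y → Bool → ℝ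
  | output E F _ _, ψ, x, y, v => outcomeProb (E x v) (F y v) ψ
  | aliceSends _ K _ next, ψ, x, y, v =>
      (next false).prob (K x false * ψ) x y v + (next true).prob (K x true * ψ) x y v
  | bobSends _ L _ next, ψ, x, y, v =>
      (next false).prob (ψ * (L y false).transpose) x y v +
        (next true).prob (ψ * (L y true).transpose) x y v

end CProtocol

/-- `C*(f)`: the number of bits sent by an optimal error-free protocol for `f` over a classical
channel, started on an arbitrary number of shared EPR pairs (`⊤` if there is no protocol).
Error-free: with probability `1` both parties announce `f x y`. -/
def Cstar {X Y : Type} (f : X → Y → Bool) : ℕ∞ :=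
  ⨅ (k : ℕ) (P : CProtocol X Y (2 ^ k) (2 ^ k))
    (_ : ∀ x y, P.prob (eprState k) x y (f x y) = 1), (P.cost : ℕ∞)

/-! ### Quantum protocols with a quantum channel -/

/-- Protocols with quantum registers `ℂ^p` (Alice) and `ℂ^q` (Bob) and a quantum channel. In a step,
a party applies to its register an isometry `ℂ^p → ℂ^p' ⊗ ℂ²` chosen according to its input (that
is, a unitary operator on the register and fresh ancillas), and sends the last qubit, which joins
the register of the other party. The order in which the parties send is fixed beforehand.
Measurements within the protocol can be postponed to its end. At the end each party measures its
register and announces the outcome. -/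
inductive QProtocol (X Y : Type) : ℕ → ℕ → Type
  | output {p q : ℕ} (E : X → Bool → Matrix (Fin p) (Fin p) ℂ)
      (F : Y → Bool → Matrix (Fin q) (Fin q) ℂ)
      (hE : ∀ x, IsPOVM (E x)) (hF : ∀ y, IsPOVM (F y)) : QProtocol X Y p q
  | aliceSends {p q : ℕ} (p' : ℕ) (K : X → Bool → Matrix (Fin p') (Fin p) ℂ)
      (hK : ∀ x, IsIsometryPair (K x)) (next : QProtocol X Y p' (2 * q)) : QProtocol X Y p q
  | bobSends {p q : ℕ} (q' : ℕ) (L : Y → Bool → Matrix (Fin q') (Fin q) ℂ)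
      (hL : ∀ y, IsIsometryPair (L y)) (next : QProtocol X Y (2 * p) q') : QProtocol X Y p q

/-- The state after a qubit has joined Bob's register: `ψ b` is the (unnormalized) state of the
remaining registers that goes with the value `b` of the qubit. -/
def joinBob {p q : ℕ} (ψ : Bool → Matrix (Fin p) (Fin q) ℂ) : Matrix (Fin p) (Fin (2 * q)) ℂ :=
  Matrix.of fun i j =>
    ψ (finTwoEquiv (finProdFinEquiv.symm j).1) i (finProdFinEquiv.symm j).2

/-- The state after a qubit has joined Alice's register: `ψ b` is the (unnormalized) state of the
remaining registers that goes with the value `b` of the qubit. -/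
def joinAlice {p q : ℕ} (ψ : Bool → Matrix (Fin p) (Fin q) ℂ) : Matrix (Fin (2 * p)) (Fin q) ℂ :=
  Matrix.of fun i j =>
    ψ (finTwoEquiv (finProdFinEquiv.symm i).1) (finProdFinEquiv.symm i).2 j

namespace QProtocol

/-- The number of qubits sent. -/
def cost {X Y : Type} {p q : ℕ} : QProtocol X Y p q → ℕ
  | output _ _ _ _ => 0
  | aliceSends _ _ _ next => 1 + next.cost
  | bobSends _ _ _ next => 1 + next.cost

/-- The probability that both parties announce `v`, on inputs `x`, `y` and initial state `ψ`. -/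
def prob {X Y : Type} {p q : ℕ} :
    QProtocol X Y p q → Matrix (Fin p) (Fin q) ℂ → X → Y → Bool → ℝ
  | output E F _ _, ψ, x, y, v => outcomeProb (E x v) (F y v) ψ
  | aliceSends _ K _ next, ψ, x, y, v => next.prob (joinBob fun b => K x b * ψ) x y v
  | bobSends _ L _ next, ψ, x, y, v => next.prob (joinAlice fun b => ψ * (L y b).transpose) x y v

end QProtocol

/-- `Q*(f)`: the number of qubits sent by an optimal error-free protocol for `f` over a quantum
channel, started on an arbitrary number of shared EPR pairs (`⊤` if there is no protocol).
Error-free: with probability `1` both parties announce `f x y`. -/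
def Qstar {X Y : Type} (f : X → Y → Bool) : ℕ∞ :=
  ⨅ (k : ℕ) (P : QProtocol X Y (2 ^ k) (2 ^ k))
    (_ : ∀ x y, P.prob (eprState k) x y (f x y) = 1), (P.cost : ℕ∞)

/-! ### The matrix of a function and the Krawtchouk values -/

/-- The `0`-`1` matrix `M_f`, with rows and columns indexed by bit strings. -/
def commMatrix {n : ℕ} (f : Bits n → Bits n → Bool) : Matrix (Bits n) (Bits n) ℝ :=
  Matrix.of fun x y => if f x y then 1 else 0

/-- The number of ones in a bit string. -/
def ones {n : ℕ} (z : Bits n) : ℕ := (Finset.univ.filter fun i => z i = true).card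

/-- The vector `v_z`, with `v_z(x) = (-1)^(∑ i, x_i z_i)`. -/
def parityVec {n : ℕ} (z x : Bits n) : ℝ := (-1) ^ ∑ i, (x i).toNat * (z i).toNat

/-- `f(a, n, m) = ∑ (-1)^k (m choose k) (n - m choose a - k)`, the sum over
`max {0, a + m - n} ≤ k ≤ min {a, m}`, for `m ≤ n` (the lower end is a truncated difference). -/
def krawtchouk (a n m : ℕ) : ℤ :=
  ∑ k ∈ Finset.Icc (a + m - n) (min a m),
    (m.choose k : ℤ) * ((n - m).choose (a - k) : ℤ) * (-1) ^ k

end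

end HamComm

/-! All three lower bounds are rank bounds. Fix the outcome "both announce `1`". For `c` classical
bits its acceptance operator is a sum of at most `2 ^ c` local terms `A r x ⊗ B r y`; for `c`
qubits, `4 ^ c` terms suffice (`exists_localSum`). The operator lies between `0` and `1`, so
exactness forces it to annihilate or to fix the EPR state. As a matrix of amplitudes that state is a
multiple of the identity, and the condition becomes `∑ r, A r x * (B r y)ᵀ = f x y • 1`
(`sum_mul_transpose_of_exact`). Hence `M ⊗ 1_d` factors through dimension `|R| * d`; the dimension
`d` of the entanglement cancels, and `rank M ≤ |R|` (`card_le_of_sum_mul_eq`).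

For the rank, `M` is a convolution on `(ℤ/2)^n`, so the characters diagonalize it. The eigenvalue at
`z` is a nonzero polynomial of degree at most `a` in the weight of `z`, so it vanishes on at most
`a` weights. Each weight has at most `n.choose (n / 2) ≤ 2 ^ n / √(n + 1)` strings. For `a ≤ √n / 4`
fewer than half of the eigenvalues vanish, so `2 ^ n < 2 * |R|`, and integrality of the cost gives
the bounds without loss. -/

namespace HamComm

open Matrix

/-! ### Local operators on a bipartite state -/

/-- A complex matrix with a nonnegative quadratic form is positive semidefinite. -/
lemma posSemidef_of_quadForm_nonneg {ι : Type*} [Fintype ι] [DecidableEq ι] {T : Matrix ι ι ℂ}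
    (h : ∀ φ, 0 ≤ star φ ⬝ᵥ (T *ᵥ φ)) : T.PosSemidef := by
  rw [posSemidef_iff_dotProduct_mulVec]
  refine ⟨?_, h⟩
  -- Over `ℂ`, an operator whose quadratic form is real is already self-adjoint.
  rw [← isSymmetric_toEuclideanLin_iff, LinearMap.isSymmetric_iff_inner_map_self_real]
  intro v
  have h2 := Complex.conj_eq_iff_im.2 (Complex.nonneg_iff.1 (h (WithLp.ofLp v))).2.symm
  rw [EuclideanSpace.inner_eq_star_dotProduct, dotProduct_comm, star_dotProduct]
  simpa using h2.symm

/-- The operator `∑ r, A r ⊗ B r` applied to the joint state `ψ`. -/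
noncomputable def localSum {R : Type} [Fintype R] {p q : ℕ} (A : R → Matrix (Fin p) (Fin p) ℂ)
    (B : R → Matrix (Fin q) (Fin q) ℂ) (ψ : Matrix (Fin p) (Fin q) ℂ) :
    Matrix (Fin p) (Fin q) ℂ :=
  ∑ r, A r * ψ * (B r)ᵀ

/-- `vec` stacks columns, so Bob's index comes first and the Kronecker factors appear in the order
`B`, `A`. -/
lemma mulVec_vec_localSum {R : Type} [Fintype R] {p q : ℕ} (A : R → Matrix (Fin p) (Fin p) ℂ)
    (B : R → Matrix (Fin q) (Fin q) ℂ) (ψ : Matrix (Fin p) (Fin q) ℂ) :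
    (∑ r, kronecker (B r) (A r)) *ᵥ vec ψ = vec (localSum A B ψ) := by
  simp only [localSum, vec_sum, sum_mulVec]
  exact Finset.sum_congr rfl fun r _ => kronecker_mulVec_vec _ _ _

lemma exists_vec_eq {p q : ℕ} (φ : Fin q × Fin p → ℂ) :
    ∃ ψ : Matrix (Fin p) (Fin q) ℂ, vec ψ = φ := vec_bijective.surjective φ

/-- A positive operator annihilates the states on which its quadratic form vanishes. -/
lemma localSum_eq_zero {R : Type} [Fintype R] {p q : ℕ} {A : R → Matrix (Fin p) (Fin p) ℂ}
    {B : R → Matrix (Fin q) (Fin q) ℂ} (h : ∀ φ, 0 ≤ trace (φᴴ * localSum A B φ))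
    {ψ : Matrix (Fin p) (Fin q) ℂ} (hψ : trace (ψᴴ * localSum A B ψ) = 0) :
    localSum A B ψ = 0 := by
  have hT : (∑ r, kronecker (B r) (A r)).PosSemidef := posSemidef_of_quadForm_nonneg fun φ => by
    obtain ⟨χ, rfl⟩ := exists_vec_eq φ
    rw [mulVec_vec_localSum, star_vec_dotProduct_vec]
    exact h χ
  have := (hT.dotProduct_mulVec_zero_iff (vec ψ)).1
    (by rw [mulVec_vec_localSum, star_vec_dotProduct_vec, hψ])
  rwa [mulVec_vec_localSum, vec_eq_zero_iff] at this

/-- An operator between `0` and `1` fixes the states on which its quadratic form is maximal. -/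
lemma localSum_eq_self {R : Type} [Fintype R] {p q : ℕ} {A : R → Matrix (Fin p) (Fin p) ℂ}
    {B : R → Matrix (Fin q) (Fin q) ℂ} (h : ∀ φ, trace (φᴴ * localSum A B φ) ≤ trace (φᴴ * φ))
    {ψ : Matrix (Fin p) (Fin q) ℂ} (hψ : trace (ψᴴ * localSum A B ψ) = trace (ψᴴ * ψ)) :
    localSum A B ψ = ψ := by
  have hT : (1 - ∑ r, kronecker (B r) (A r)).PosSemidef := posSemidef_of_quadForm_nonneg fun φ => by
    obtain ⟨χ, rfl⟩ := exists_vec_eq φ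
    rw [sub_mulVec, one_mulVec, mulVec_vec_localSum, dotProduct_sub, star_vec_dotProduct_vec,
      star_vec_dotProduct_vec]
    exact sub_nonneg.2 (h χ)
  have := (hT.dotProduct_mulVec_zero_iff (vec ψ)).1
    (by rw [sub_mulVec, one_mulVec, mulVec_vec_localSum, dotProduct_sub, star_vec_dotProduct_vec,
      star_vec_dotProduct_vec, hψ, sub_self])
  rw [sub_mulVec, one_mulVec, mulVec_vec_localSum, sub_eq_zero] at this
  exact (vec_inj.1 this).symm

/-- The joint outcome probability of two local measurements is real and nonnegative. -/
lemma trace_local_nonneg {p q : ℕ} {E : Matrix (Fin p) (Fin p) ℂ} {F : Matrix (Fin q) (Fin q) ℂ}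
    (hE : E.PosSemidef) (hF : F.PosSemidef) (ψ : Matrix (Fin p) (Fin q) ℂ) :
    0 ≤ trace (ψᴴ * (E * ψ * Fᵀ)) := by
  have := (hF.kronecker hE).dotProduct_mulVec_nonneg (vec ψ)
  rwa [kronecker_mulVec_vec, star_vec_dotProduct_vec] at this

lemma coe_outcomeProb {p q : ℕ} {E : Matrix (Fin p) (Fin p) ℂ} {F : Matrix (Fin q) (Fin q) ℂ}
    (hE : E.PosSemidef) (hF : F.PosSemidef) (ψ : Matrix (Fin p) (Fin q) ℂ) :
    (outcomeProb E F ψ : ℂ) = trace (ψᴴ * (E * ψ * Fᵀ)) :=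
  Complex.ext (by simp [outcomeProb])
    (by simpa using (Complex.nonneg_iff.1 (trace_local_nonneg hE hF ψ)).2)

lemma outcomeProb_nonneg {p q : ℕ} {E : Matrix (Fin p) (Fin p) ℂ} {F : Matrix (Fin q) (Fin q) ℂ}
    (hE : E.PosSemidef) (hF : F.PosSemidef) (ψ : Matrix (Fin p) (Fin q) ℂ) :
    0 ≤ outcomeProb E F ψ :=
  (Complex.nonneg_iff.1 (trace_local_nonneg hE hF ψ)).1

/-- The probability that both measurements have the same outcome is at most the squared norm. -/
lemma outcomeProb_add_le {p q : ℕ} {E : Bool → Matrix (Fin p) (Fin p) ℂ}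
    {F : Bool → Matrix (Fin q) (Fin q) ℂ} (hE : IsPOVM E) (hF : IsPOVM F)
    (ψ : Matrix (Fin p) (Fin q) ℂ) :
    outcomeProb (E false) (F false) ψ + outcomeProb (E true) (F true) ψ
      ≤ (trace (ψᴴ * ψ)).re := by
  -- The four joint outcomes share the squared norm; the two in which the parties disagree are
  -- dropped.
  have h1 := outcomeProb_nonneg (hE.1 false) (hF.1 true) ψ
  have h2 := outcomeProb_nonneg (hE.1 true) (hF.1 false) ψ
  have h : trace (ψᴴ * ψ) = trace (ψᴴ * (((E false + E true) * ψ * (F false + F true)ᵀ))) := by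
    rw [hE.2, hF.2]; simp
  rw [h]
  simp only [transpose_add, Matrix.mul_add, Matrix.add_mul, trace_add, Complex.add_re]
  simp only [outcomeProb] at *
  linarith

lemma trace_isometryPair_left {p p' q : ℕ} {K : Bool → Matrix (Fin p') (Fin p) ℂ}
    (hK : IsIsometryPair K) (ψ : Matrix (Fin p) (Fin q) ℂ) :
    trace ((K false * ψ)ᴴ * (K false * ψ)) + trace ((K true * ψ)ᴴ * (K true * ψ)) =
      trace (ψᴴ * ψ) := by
  have h : ψᴴ * ψ = ψᴴ * (((K false)ᴴ * K false + (K true)ᴴ * K true) * ψ) := by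
    rw [show _ = _ from hK, Matrix.one_mul]
  rw [h]
  simp only [conjTranspose_mul, Matrix.mul_add, Matrix.add_mul, trace_add, Matrix.mul_assoc]

lemma trace_conjTranspose_mul_transpose {p q : ℕ} (φ : Matrix (Fin p) (Fin q) ℂ) :
    trace (φᴴ * φ) = trace ((φᵀ)ᴴ * φᵀ) := by
  rw [← trace_transpose, transpose_mul, trace_mul_comm]
  rfl

lemma trace_isometryPair_right {p q q' : ℕ} {L : Bool → Matrix (Fin q') (Fin q) ℂ}
    (hL : IsIsometryPair L) (ψ : Matrix (Fin p) (Fin q) ℂ) :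
    trace ((ψ * (L false)ᵀ)ᴴ * (ψ * (L false)ᵀ)) + trace ((ψ * (L true)ᵀ)ᴴ * (ψ * (L true)ᵀ)) =
      trace (ψᴴ * ψ) := by
  rw [trace_conjTranspose_mul_transpose (ψ * (L false)ᵀ),
    trace_conjTranspose_mul_transpose (ψ * (L true)ᵀ), trace_conjTranspose_mul_transpose ψ]
  simpa using trace_isometryPair_left hL ψᵀ

/-- Cyclicity of the trace. The bra and ket operators may differ because a message qubit in
superposition produces cross terms. -/
lemma trace_sandwich {p p' q q' : ℕ} (A : Matrix (Fin p') (Fin p') ℂ)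
    (B : Matrix (Fin q') (Fin q') ℂ) (C C' : Matrix (Fin p') (Fin p) ℂ)
    (D D' : Matrix (Fin q') (Fin q) ℂ) (ψ : Matrix (Fin p) (Fin q) ℂ) :
    trace ((C * ψ * Dᵀ)ᴴ * (A * (C' * ψ * D'ᵀ) * Bᵀ)) =
      trace (ψᴴ * ((Cᴴ * A * C') * ψ * (Dᴴ * B * D')ᵀ)) := by
  rw [conjTranspose_mul, Matrix.mul_assoc, trace_mul_comm, transpose_mul, transpose_mul]
  simp only [conjTranspose_mul, Matrix.mul_assoc]
  rfl

/-! ### Acceptance operators over a classical channel -/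

namespace CProtocol

variable {X Y : Type}

/-- The acceptance operator of a protocol with `c` classical bits is a sum of `2 ^ c` local
operators, and the probability of the outcome is its quadratic form. -/
lemma exists_localSum {p q : ℕ} (P : CProtocol X Y p q) (v : Bool) :
    ∃ (R : Type) (_ : Fintype R) (A : R → X → Matrix (Fin p) (Fin p) ℂ)
      (B : R → Y → Matrix (Fin q) (Fin q) ℂ), Fintype.card R ≤ 2 ^ P.cost ∧
      ∀ x y ψ, (P.prob ψ x y v : ℂ) = trace (ψᴴ * localSum (A · x) (B · y) ψ) := by
  induction P with
  | output E F hE hF =>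
    refine ⟨Unit, inferInstance, fun _ x => E x v, fun _ y => F y v, by simp [cost], fun x y ψ => ?_⟩
    simp [prob, localSum, coe_outcomeProb ((hE x).1 v) ((hF y).1 v)]
  | aliceSends p' K hK next ih =>
    obtain ⟨R₀, _, A₀, B₀, h₀, e₀⟩ := ih false
    obtain ⟨R₁, _, A₁, B₁, h₁, e₁⟩ := ih true
    -- The probabilities of the two branches add, so the terms of the two subtrees are collected
    -- side by side.
    refine ⟨R₀ ⊕ R₁, inferInstance,
      Sum.elim (fun r x => (K x false)ᴴ * A₀ r x * K x false)
        (fun r x => (K x true)ᴴ * A₁ r x * K x true), Sum.elim B₀ B₁, ?_, fun x y ψ => ?_⟩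
    · rw [Fintype.card_sum, cost, pow_add]
      have := Nat.pow_le_pow_right (n := 2) (by norm_num)
        (le_max_left (next false).cost (next true).cost)
      have := Nat.pow_le_pow_right (n := 2) (by norm_num)
        (le_max_right (next false).cost (next true).cost)
      omega
    · simp only [prob, Complex.ofReal_add, e₀, e₁, localSum, Fintype.sum_sum_type, Sum.elim_inl,
        Sum.elim_inr, Matrix.mul_add, trace_add, Matrix.mul_sum, trace_sum]
      congr 1 <;> refine Finset.sum_congr rfl fun r _ => ?_
      · simpa using trace_sandwich (A₀ r x) (B₀ r y) (K x false) (K x false) 1 1 ψ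
      · simpa using trace_sandwich (A₁ r x) (B₁ r y) (K x true) (K x true) 1 1 ψ
  | bobSends q' L hL next ih =>
    obtain ⟨R₀, _, A₀, B₀, h₀, e₀⟩ := ih false
    obtain ⟨R₁, _, A₁, B₁, h₁, e₁⟩ := ih true
    refine ⟨R₀ ⊕ R₁, inferInstance, Sum.elim A₀ A₁,
      Sum.elim (fun r y => (L y false)ᴴ * B₀ r y * L y false)
        (fun r y => (L y true)ᴴ * B₁ r y * L y true), ?_, fun x y ψ => ?_⟩
    · rw [Fintype.card_sum, cost, pow_add]
      have := Nat.pow_le_pow_right (n := 2) (by norm_num)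
        (le_max_left (next false).cost (next true).cost)
      have := Nat.pow_le_pow_right (n := 2) (by norm_num)
        (le_max_right (next false).cost (next true).cost)
      omega
    · simp only [prob, Complex.ofReal_add, e₀, e₁, localSum, Fintype.sum_sum_type, Sum.elim_inl,
        Sum.elim_inr, Matrix.mul_add, trace_add, Matrix.mul_sum, trace_sum]
      congr 1 <;> refine Finset.sum_congr rfl fun r _ => ?_
      · simpa using trace_sandwich (A₀ r x) (B₀ r y) 1 1 (L y false) (L y false) ψ
      · simpa using trace_sandwich (A₁ r x) (B₁ r y) 1 1 (L y true) (L y true) ψ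

lemma prob_nonneg {p q : ℕ} (P : CProtocol X Y p q) (ψ : Matrix (Fin p) (Fin q) ℂ) (x : X) (y : Y)
    (v : Bool) : 0 ≤ P.prob ψ x y v := by
  induction P with
  | output E F hE hF => exact outcomeProb_nonneg ((hE x).1 v) ((hF y).1 v) ψ
  | aliceSends p' K hK next ih => exact add_nonneg (ih _ _) (ih _ _)
  | bobSends q' L hL next ih => exact add_nonneg (ih _ _) (ih _ _)

/-- A measurement splits the squared norm between its outcomes, so the bound at the leaves
propagates to the root. -/
lemma prob_add_le {p q : ℕ} (P : CProtocol X Y p q) (ψ : Matrix (Fin p) (Fin q) ℂ) (x : X)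
    (y : Y) : P.prob ψ x y false + P.prob ψ x y true ≤ (trace (ψᴴ * ψ)).re := by
  induction P with
  | output E F hE hF => exact outcomeProb_add_le (hE x) (hF y) ψ
  | aliceSends p' K hK next ih =>
    rw [← trace_isometryPair_left (hK x), Complex.add_re]
    have h₀ := ih false (K x false * ψ)
    have h₁ := ih true (K x true * ψ)
    simp only [prob]
    linarith
  | bobSends q' L hL next ih =>
    rw [← trace_isometryPair_right (hL y), Complex.add_re]
    have h₀ := ih false (ψ * (L y false)ᵀ)
    have h₁ := ih true (ψ * (L y true)ᵀ)
    simp only [prob]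
    linarith

end CProtocol

/-! ### Acceptance operators over a quantum channel -/

/-- The isometry of `ℂ^q` into `ℂ² ⊗ ℂ^q` that adjoins the qubit `|b⟩`. -/
def adjoinQubit (q : ℕ) (b : Bool) : Matrix (Fin (2 * q)) (Fin q) ℂ :=
  Matrix.of fun j i => if j = finProdFinEquiv (finTwoEquiv.symm b, i) then 1 else 0

lemma mul_adjoinQubit_transpose {p q : ℕ} (φ : Matrix (Fin p) (Fin q) ℂ) (b : Bool) (i : Fin p)
    (j : Fin (2 * q)) : (φ * (adjoinQubit q b)ᵀ) i j =
      if finTwoEquiv (finProdFinEquiv.symm j).1 = b then φ i (finProdFinEquiv.symm j).2 else 0 := by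
  obtain ⟨⟨c, j⟩, rfl⟩ := finProdFinEquiv.surjective j
  obtain ⟨c, rfl⟩ := finTwoEquiv.symm.surjective c
  rw [mul_apply]
  simp only [adjoinQubit, transpose_apply, of_apply, EmbeddingLike.apply_eq_iff_eq, Prod.mk.injEq,
    Equiv.symm_apply_apply, Equiv.apply_symm_apply]
  by_cases h : c = b <;> simp [h]

/-- Writes the transfer of a qubit as a sum of local operators, the form needed for
`trace_localSum_pullback`. -/
lemma joinBob_eq {p q : ℕ} (ψ : Bool → Matrix (Fin p) (Fin q) ℂ) :
    joinBob ψ = ∑ b, ψ b * (adjoinQubit q b)ᵀ := by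
  ext i j
  simp only [Matrix.sum_apply, mul_adjoinQubit_transpose, Finset.sum_ite_eq, Finset.mem_univ, if_true]
  rfl

lemma joinAlice_eq {p q : ℕ} (ψ : Bool → Matrix (Fin p) (Fin q) ℂ) :
    joinAlice ψ = ∑ b, adjoinQubit p b * ψ b := by
  rw [← transpose_inj, transpose_sum]
  simp only [transpose_mul]
  exact joinBob_eq fun b => (ψ b)ᵀ

lemma adjoinQubit_conjTranspose_mul (q : ℕ) (b c : Bool) :
    (adjoinQubit q b)ᴴ * adjoinQubit q c = if b = c then 1 else 0 := by
  ext i j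
  rw [mul_apply]
  simp only [adjoinQubit, conjTranspose_apply, of_apply, mul_ite, mul_one, mul_zero,
    Finset.sum_ite_eq', Finset.mem_univ, if_true, EmbeddingLike.apply_eq_iff_eq, Prod.mk.injEq]
  by_cases h : b = c 
  · simp [h, Matrix.one_apply, eq_comm]
  · simp [h, Ne.symm h]

lemma trace_joinAlice {p q : ℕ} (ψ : Bool → Matrix (Fin p) (Fin q) ℂ) :
    trace ((joinAlice ψ)ᴴ * joinAlice ψ) =
      trace ((ψ false)ᴴ * ψ false) + trace ((ψ true)ᴴ * ψ true) := by
  have h (b c : Bool) : (ψ b)ᴴ * ((adjoinQubit p b)ᴴ * (adjoinQubit p c * ψ c)) =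
      if b = c then (ψ b)ᴴ * ψ c else 0 := by
    rw [← Matrix.mul_assoc (adjoinQubit p b)ᴴ, adjoinQubit_conjTranspose_mul]
    split_ifs <;> simp
  simp [joinAlice_eq, Matrix.mul_add, Matrix.add_mul, Matrix.mul_assoc, h, add_comm]

lemma trace_joinBob {p q : ℕ} (ψ : Bool → Matrix (Fin p) (Fin q) ℂ) :
    trace ((joinBob ψ)ᴴ * joinBob ψ) =
      trace ((ψ false)ᴴ * ψ false) + trace ((ψ true)ᴴ * ψ true) := by
  rw [trace_conjTranspose_mul_transpose, trace_conjTranspose_mul_transpose (ψ false),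
    trace_conjTranspose_mul_transpose (ψ true)]
  exact trace_joinAlice fun b => (ψ b)ᵀ

/-- Pulling a sum of local operators back along `∑ b, C b ⊗ D b`. -/
lemma trace_localSum_pullback {R : Type} [Fintype R] {p p' q q' : ℕ}
    (A : R → Matrix (Fin p') (Fin p') ℂ) (B : R → Matrix (Fin q') (Fin q') ℂ)
    (C : Bool → Matrix (Fin p') (Fin p) ℂ) (D : Bool → Matrix (Fin q') (Fin q) ℂ)
    (ψ : Matrix (Fin p) (Fin q) ℂ) :
    trace ((∑ b, C b * ψ * (D b)ᵀ)ᴴ * localSum A B (∑ b, C b * ψ * (D b)ᵀ)) =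
      trace (ψᴴ * localSum (R := R × Bool × Bool) (fun s => (C s.2.1)ᴴ * A s.1 * C s.2.2)
        (fun s => (D s.2.1)ᴴ * B s.1 * D s.2.2) ψ) := by
  simp only [localSum, Fintype.sum_prod_type, Matrix.mul_sum, Matrix.sum_mul, trace_sum,
    conjTranspose_sum, trace_sandwich]
  refine Finset.sum_congr rfl fun r _ => ?_
  rw [Finset.sum_comm]

namespace QProtocol

variable {X Y : Type}

/-- The acceptance operator of a protocol with `c` qubits is a sum of `4 ^ c` local
operators, and the probability of the outcome is its quadratic form. -/
lemma exists_localSum {p q : ℕ} (P : QProtocol X Y p q) (v : Bool) :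
    ∃ (R : Type) (_ : Fintype R) (A : R → X → Matrix (Fin p) (Fin p) ℂ)
      (B : R → Y → Matrix (Fin q) (Fin q) ℂ), Fintype.card R ≤ 2 ^ (2 * P.cost) ∧
      ∀ x y ψ, (P.prob ψ x y v : ℂ) = trace (ψᴴ * localSum (A · x) (B · y) ψ) := by
  induction P with
  | output E F hE hF =>
    refine ⟨Unit, inferInstance, fun _ x => E x v, fun _ y => F y v, by simp [cost], fun x y ψ => ?_⟩
    simp [prob, localSum, coe_outcomeProb ((hE x).1 v) ((hF y).1 v)]
  | @aliceSends p q p' K hK next ih =>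
    obtain ⟨R, _, A, B, h, e⟩ := ih
    -- The sent qubit takes independent values in bra and ket, hence a factor of four per qubit.
    refine ⟨R × Bool × Bool, inferInstance, fun s x => (K x s.2.1)ᴴ * A s.1 x * K x s.2.2,
      fun s y => (adjoinQubit q s.2.1)ᴴ * B s.1 y * adjoinQubit q s.2.2, ?_, fun x y ψ => ?_⟩
    · simp only [Fintype.card_prod, Fintype.card_bool, cost, mul_add, pow_add]
      omega
    · rw [prob, e, joinBob_eq]
      exact trace_localSum_pullback _ _ (K x) (adjoinQubit q) ψ
  | @bobSends p q q' L hL next ih =>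
    obtain ⟨R, _, A, B, h, e⟩ := ih
    refine ⟨R × Bool × Bool, inferInstance,
      fun s x => (adjoinQubit p s.2.1)ᴴ * A s.1 x * adjoinQubit p s.2.2,
      fun s y => (L y s.2.1)ᴴ * B s.1 y * L y s.2.2, ?_, fun x y ψ => ?_⟩
    · simp only [Fintype.card_prod, Fintype.card_bool, cost, mul_add, pow_add]
      omega
    · rw [prob, e, joinAlice_eq]
      simp only [← Matrix.mul_assoc (adjoinQubit p _) ψ]
      exact trace_localSum_pullback _ _ (adjoinQubit p) (L y) ψ

lemma prob_nonneg {p q : ℕ} (P : QProtocol X Y p q) (ψ : Matrix (Fin p) (Fin q) ℂ) (x : X) (y : Y)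
    (v : Bool) : 0 ≤ P.prob ψ x y v := by
  induction P with
  | output E F hE hF => exact outcomeProb_nonneg ((hE x).1 v) ((hF y).1 v) ψ
  | aliceSends p' K hK next ih => exact ih _
  | bobSends q' L hL next ih => exact ih _

lemma prob_add_le {p q : ℕ} (P : QProtocol X Y p q) (ψ : Matrix (Fin p) (Fin q) ℂ) (x : X)
    (y : Y) : P.prob ψ x y false + P.prob ψ x y true ≤ (trace (ψᴴ * ψ)).re := by
  induction P with
  | output E F hE hF => exact outcomeProb_add_le (hE x) (hF y) ψ
  | aliceSends p' K hK next ih =>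
    rw [← trace_isometryPair_left (hK x), ← trace_joinBob fun b => K x b * ψ]
    exact ih _
  | bobSends q' L hL next ih =>
    rw [← trace_isometryPair_right (hL y), ← trace_joinAlice fun b => ψ * (L y b)ᵀ]
    exact ih _

end QProtocol

/-! ### From exactness to a rank bound -/

/-- If a protocol with acceptance operators `∑ r, A r x ⊗ B r y` computes `f` without error from
the maximally entangled state, then `∑ r, A r x * (B r y)ᵀ = f x y • 1`. -/
lemma sum_mul_transpose_of_exact {X Y R : Type} [Fintype R] {k : ℕ}
    {A : R → X → Matrix (Fin (2 ^ k)) (Fin (2 ^ k)) ℂ}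
    {B : R → Y → Matrix (Fin (2 ^ k)) (Fin (2 ^ k)) ℂ} {f : X → Y → Bool}
    {pr : Matrix (Fin (2 ^ k)) (Fin (2 ^ k)) ℂ → X → Y → Bool → ℝ}
    (hpr : ∀ x y ψ, (pr ψ x y true : ℂ) = trace (ψᴴ * localSum (A · x) (B · y) ψ))
    (hnonneg : ∀ ψ x y v, 0 ≤ pr ψ x y v)
    (hle : ∀ ψ x y, pr ψ x y false + pr ψ x y true ≤ (trace (ψᴴ * ψ)).re)
    (hf : ∀ x y, pr (eprState k) x y (f x y) = 1) (x : X) (y : Y) :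
    ∑ r, A r x * (B r y)ᵀ = if f x y then 1 else 0 := by
  set s : ℂ := ((1 / Real.sqrt (2 ^ k) : ℝ) : ℂ) with hs
  have hs0 : s ≠ 0 := by rw [hs]; exact_mod_cast (by positivity : (1 / Real.sqrt (2 ^ k) : ℝ) ≠ 0)
  have hnorm : trace ((eprState k)ᴴ * eprState k) = 1 := by
    have : (1 / Real.sqrt (2 ^ k) : ℝ) * ((1 / Real.sqrt (2 ^ k) : ℝ) * 2 ^ k) = 1 := by
      have h := Real.mul_self_sqrt (by positivity : (0 : ℝ) ≤ 2 ^ k)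
      have h' : Real.sqrt (2 ^ k) ≠ 0 := by positivity
      field_simp
      nlinarith
    have := congrArg (fun t : ℝ => (t : ℂ)) this
    simpa [eprState] using this
  -- Since the EPR state is `s • 1`, the action of `A ⊗ B` on it is the matrix product `A * Bᵀ`.
  have hsum : localSum (A · x) (B · y) (eprState k) = s • ∑ r, A r x * (B r y)ᵀ := by
    simp [localSum, eprState, Finset.smul_sum, hs]
  have hpos (φ) : 0 ≤ trace (φᴴ * localSum (A · x) (B · y) φ) := by
    rw [← hpr]; exact_mod_cast hnonneg φ x y true
  cases hv : f x y with
  | false =>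
    -- The outcome `false` already exhausts the norm of the state.
    have h0 : pr (eprState k) x y true = 0 := by
      have h1 := hle (eprState k) x y
      have h2 := hf x y
      rw [hv] at h2
      rw [hnorm, h2, Complex.one_re] at h1
      linarith [hnonneg (eprState k) x y true]
    have := localSum_eq_zero hpos (ψ := eprState k) (by rw [← hpr, h0, Complex.ofReal_zero])
    rw [hsum, smul_eq_zero] at this
    simpa using this.resolve_left hs0
  | true =>
    have h1 := hf x y
    rw [hv] at h1
    have := localSum_eq_self (A := (A · x)) (B := (B · y)) (ψ := eprState k) (fun φ => ?_)
      (by rw [← hpr, h1, hnorm, Complex.ofReal_one])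
    · rw [hsum, eprState] at this
      simpa using smul_right_injective _ hs0 this
    · have hφ : 0 ≤ trace (φᴴ * φ) := (posSemidef_conjTranspose_mul_self φ).trace_nonneg
      rw [← hpr, Complex.le_def]
      refine ⟨?_, by simpa using (Complex.nonneg_iff.1 hφ).2⟩
      rw [Complex.ofReal_re]
      linarith [hle φ x y, hnonneg φ x y false]

/-- If `M ⊗ 1` is a sum of `|R|` products of operator-valued functions of the row and of the
column, then `|R|` bounds the number of nonzero entries of a diagonalization of `M`. -/
lemma card_le_of_sum_mul_eq {X Y R Z : Type} [Fintype X] [Fintype Y] [Fintype R] [Fintype Z]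
    [DecidableEq Z] {d : ℕ} (hd : 0 < d) {A : R → X → Matrix (Fin d) (Fin d) ℂ}
    {B : R → Y → Matrix (Fin d) (Fin d) ℂ} {M : X → Y → ℂ}
    (h : ∀ x y, ∑ r, A r x * B r y = M x y • 1) {u : Z → X → ℂ} {w : Z → Y → ℂ} {μ : Z → ℂ}
    (hμ : ∀ z, μ z ≠ 0)
    (hM : ∀ z z', ∑ x, ∑ y, u z x * w z' y * M x y = if z = z' then μ z else 0) :
    Fintype.card Z ≤ Fintype.card R := by
  let a (z : Z) (r : R) : Matrix (Fin d) (Fin d) ℂ := ∑ x, u z x • A r x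
  let b (r : R) (z : Z) : Matrix (Fin d) (Fin d) ℂ := ∑ y, w z y • B r y
  have hab (z z') : ∑ r, a z r * b r z' = (if z = z' then μ z else 0) • 1 := by
    rw [← hM]
    calc ∑ r, a z r * b r z'
        = ∑ r, ∑ x, ∑ y, (u z x * w z' y) • (A r x * B r y) := by
          simp only [a, b, Matrix.sum_mul, Matrix.mul_sum, smul_mul_smul_comm]
          exact Finset.sum_congr rfl fun r _ => Finset.sum_comm
      _ = ∑ x, ∑ y, (u z x * w z' y) • ∑ r, A r x * B r y := by
          rw [Finset.sum_comm]
          refine Finset.sum_congr rfl fun x _ => ?_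
          rw [Finset.sum_comm]
          simp only [Finset.smul_sum]
      _ = _ := by simp only [h, Finset.sum_smul, smul_smul]
  -- Block matrices with `U * W = diag μ ⊗ 1`, which is invertible; the inner dimension is `|R| *
  -- d`.
  let U : Matrix (Z × Fin d) (R × Fin d) ℂ := Matrix.of fun s t => a s.1 t.1 s.2 t.2
  let W : Matrix (R × Fin d) (Z × Fin d) ℂ := Matrix.of fun t s => b t.1 s.1 t.2 s.2
  have hUW : U * W = diagonal fun s => μ s.1 := by
    ext ⟨z, i⟩ ⟨z', j⟩
    have := congrFun (congrFun (hab z z') i) j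
    simp only [Matrix.sum_apply, mul_apply] at this
    simp only [mul_apply, U, W, of_apply, Fintype.sum_prod_type, this, diagonal_apply,
      Matrix.smul_apply, Matrix.one_apply, Prod.mk.injEq]
    by_cases h : z = z' <;> by_cases h' : i = j <;> simp [h, h']
  have hrank : (U * W).rank = Fintype.card (Z × Fin d) := by
    rw [hUW]
    refine rank_of_det_ne_zero ?_
    rw [det_diagonal]
    exact Finset.prod_ne_zero_iff.2 fun s _ => hμ s.1
  have hle := (rank_mul_le_left U W).trans (rank_le_card_width U)
  rw [hrank, Fintype.card_prod, Fintype.card_prod, Fintype.card_fin] at hle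
  exact Nat.le_of_mul_le_mul_right hle hd

/-! ### Deterministic protocols -/

namespace DProtocol

variable {X Y : Type}

/-- A protocol with `c` bits decomposes the matrix of its value into `2 ^ c` matrices of rank at
most one, one for each leaf. -/
lemma exists_sum_mul (P : DProtocol X Y) :
    ∃ (R : Type) (_ : Fintype R) (A : R → X → ℂ) (B : R → Y → ℂ), Fintype.card R ≤ 2 ^ P.cost ∧
      ∀ x y, ∑ r, A r x * B r y = if P.run x y = (true, true) then 1 else 0 := by
  induction P with
  | output u v =>
    refine ⟨Unit, inferInstance, fun _ x => if u x then 1 else 0,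
      fun _ y => if v y then 1 else 0, by simp [cost], fun x y => ?_⟩
    cases hu : u x <;> cases hv : v y <;> simp [run, hu, hv]
  | aliceSends msg next ih =>
    obtain ⟨R₀, _, A₀, B₀, h₀, e₀⟩ := ih false
    obtain ⟨R₁, _, A₁, B₁, h₁, e₁⟩ := ih true
    refine ⟨R₀ ⊕ R₁, inferInstance,
      Sum.elim (fun r x => if msg x then 0 else A₀ r x) (fun r x => if msg x then A₁ r x else 0),
      Sum.elim B₀ B₁, ?_, fun x y => ?_⟩
    · rw [Fintype.card_sum, cost, pow_add]
      have := Nat.pow_le_pow_right (n := 2) (by norm_num)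
        (le_max_left (next false).cost (next true).cost)
      have := Nat.pow_le_pow_right (n := 2) (by norm_num)
        (le_max_right (next false).cost (next true).cost)
      omega
    · cases hm : msg x <;> simp [run, hm, e₀, e₁]
  | bobSends msg next ih =>
    obtain ⟨R₀, _, A₀, B₀, h₀, e₀⟩ := ih false
    obtain ⟨R₁, _, A₁, B₁, h₁, e₁⟩ := ih true
    refine ⟨R₀ ⊕ R₁, inferInstance, Sum.elim A₀ A₁,
      Sum.elim (fun r y => if msg y then 0 else B₀ r y) (fun r y => if msg y then B₁ r y else 0),
      ?_, fun x y => ?_⟩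
    · rw [Fintype.card_sum, cost, pow_add]
      have := Nat.pow_le_pow_right (n := 2) (by norm_num)
        (le_max_left (next false).cost (next true).cost)
      have := Nat.pow_le_pow_right (n := 2) (by norm_num)
        (le_max_right (next false).cost (next true).cost)
      omega
    · cases hm : msg y <;> simp [run, hm, e₀, e₁]

end DProtocol

/-! ### Characters of the cube and the eigenvalues -/

open Polynomial

lemma parityVec_eq_prod {n : ℕ} (z x : Bits n) :
    parityVec z x = ∏ i, (-1 : ℝ) ^ ((x i).toNat * (z i).toNat) := by
  rw [parityVec, Finset.prod_pow_eq_pow_sum]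

lemma parityVec_comm {n : ℕ} (z x : Bits n) : parityVec z x = parityVec x z := by
  simp only [parityVec, mul_comm]

lemma ones_eq_sum {n : ℕ} (z : Bits n) : ones z = ∑ i, (z i).toNat := by
  rw [ones, Finset.card_filter]
  exact Finset.sum_congr rfl fun i _ => by cases z i <;> rfl

lemma ones_le {n : ℕ} (z : Bits n) : ones z ≤ n := by
  simpa [ones] using Finset.card_filter_le Finset.univ fun i => z i = true

/-- Distributivity: sums of product functions over the cube factor over the coordinates. -/
lemma sum_bits_prod {n : ℕ} {S : Type*} [CommSemiring S] (g : Fin n → Bool → S) :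
    ∑ x : Bits n, ∏ i, g i (x i) = ∏ i, (g i false + g i true) := by
  rw [← Fintype.piFinset_univ, ← Finset.prod_univ_sum]
  simp [add_comm]

lemma sum_parityVec_mul {n : ℕ} (z z' : Bits n) :
    ∑ x, parityVec z x * parityVec z' x = if z = z' then (2 : ℝ) ^ n else 0 := by
  simp only [parityVec_eq_prod, ← Finset.prod_mul_distrib]
  rw [sum_bits_prod fun i b => (-1 : ℝ) ^ (b.toNat * (z i).toNat) *
    (-1 : ℝ) ^ (b.toNat * (z' i).toNat)]
  split_ifs with h
  · subst h
    rw [Finset.prod_congr rfl (g := fun _ => (2 : ℝ)) fun i _ => by cases z i <;> norm_num]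
    simp
  -- A coordinate where `z` and `z'` differ contributes the factor `1 + (-1) = 0`.
  · obtain ⟨i, hi⟩ := Function.ne_iff.1 h
    refine Finset.prod_eq_zero (Finset.mem_univ i) ?_
    cases h₁ : z i <;> cases h₂ : z' i <;> simp_all

lemma parityVec_mul_self {n : ℕ} (z x : Bits n) : parityVec z x * parityVec z x = 1 := by
  rw [parityVec, ← mul_pow]
  norm_num

/-- The character property; with `hammingDist_xor` it turns the action of `M` on `parityVec z` into
a sum over differences `w`. -/
lemma parityVec_xor {n : ℕ} (z x w : Bits n) :
    parityVec z (fun i => xor (x i) (w i)) = parityVec z x * parityVec z w := by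
  simp only [parityVec_eq_prod, ← Finset.prod_mul_distrib]
  refine Finset.prod_congr rfl fun i _ => ?_
  cases x i <;> cases w i <;> cases z i <;> norm_num

lemma hammingDist_xor {n : ℕ} (x w : Bits n) :
    hammingDist x (fun i => xor (x i) (w i)) = ones w := by
  rw [hammingDist, ones]
  congr 1
  ext i
  cases h : x i <;> cases h' : w i <;> simp [h, h']

/-- The bijection `w ↦ x ⊕ w`. -/
def xorEquiv {n : ℕ} (x : Bits n) : Bits n ≃ Bits n where
  toFun w i := xor (x i) (w i)
  invFun w i := xor (x i) (w i)
  left_inv w := by ext i; simp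
  right_inv w := by ext i; simp

lemma coeff_one_sub_X_pow (m k : ℕ) :
    ((1 - X : ℝ[X]) ^ m).coeff k = (m.choose k : ℝ) * (-1) ^ k := by
  have : (1 - X : ℝ[X]) ^ m = ((1 + X) ^ m).comp (-X) := by simp [sub_eq_add_neg]
  rw [this, show (-X : ℝ[X]) = C (-1) * X by simp, comp_C_mul_X_coeff, coeff_one_add_X_pow]

lemma krawtchouk_eq_sum_range {a n m : ℕ} (hm : m ≤ n) :
    krawtchouk a n m = ∑ k ∈ Finset.range (a + 1),
      (m.choose k : ℤ) * ((n - m).choose (a - k) : ℤ) * (-1) ^ k := by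
  rw [krawtchouk]
  refine Finset.sum_subset (fun k hk => ?_) fun k hk hk' => ?_
  · rw [Finset.mem_Icc] at hk
    rw [Finset.mem_range]
    omega
  · rw [Finset.mem_range] at hk
    rw [Finset.mem_Icc] at hk'
    rcases lt_or_ge m k with h | h
    · simp [Nat.choose_eq_zero_of_lt h]
    · simp [Nat.choose_eq_zero_of_lt (show n - m < a - k by omega)]

/-- Compare coefficients of `X ^ a` in the generating function `∑ w, χ_z(w) X^|w| = (1 - X)^|z| (1 +
X)^(n - |z|)`, which factors over the coordinates. -/
lemma sum_parityVec_ones {n : ℕ} (a : ℕ) (z : Bits n) :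
    ∑ w, (if ones w = a then parityVec z w else 0) = (krawtchouk a n (ones z) : ℝ) := by
  have h1 : ∑ w : Bits n, C (parityVec z w) * X ^ ones w =
      (1 - X : ℝ[X]) ^ ones z * (1 + X) ^ (n - ones z) := by
    simp only [parityVec_eq_prod, ones_eq_sum, map_prod, ← Finset.prod_pow_eq_pow_sum,
      ← Finset.prod_mul_distrib]
    rw [sum_bits_prod fun i b => C ((-1 : ℝ) ^ (b.toNat * (z i).toNat)) * X ^ b.toNat]
    rw [Finset.prod_congr rfl (g := fun i => if z i = true then (1 - X : ℝ[X]) else 1 + X)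
      fun i _ => by cases z i <;> simp [sub_eq_add_neg]]
    rw [Finset.prod_ite, Finset.prod_const, Finset.prod_const, Finset.prod_pow_eq_pow_sum,
      ← ones_eq_sum, ← Finset.compl_filter, Finset.card_compl, Fintype.card_fin, ones]
  have h2 := congrArg (fun p : ℝ[X] => p.coeff a) h1
  simp only [finsetSum_coeff, coeff_C_mul, coeff_X_pow, mul_ite, mul_one, mul_zero] at h2
  simp only [coeff_mul, coeff_one_sub_X_pow, coeff_one_add_X_pow] at h2
  rw [krawtchouk_eq_sum_range (ones_le z)]
  rw [Finset.Nat.sum_antidiagonal_eq_sum_range_succ_mk] at h2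
  push_cast
  simp only [eq_comm (b := a), h2]
  exact Finset.sum_congr rfl fun k _ => by ring

lemma commMatrix_mulVec_parityVec {n : ℕ} (a : ℕ) (z : Bits n) :
    commMatrix (hamEq n a) *ᵥ parityVec z = (krawtchouk a n (ones z) : ℝ) • parityVec z := by
  ext x
  rw [mulVec, dotProduct, ← (xorEquiv x).sum_comp, Pi.smul_apply, smul_eq_mul,
    ← sum_parityVec_ones, Finset.sum_mul]
  refine Finset.sum_congr rfl fun w _ => ?_
  change (if decide (hammingDist x (fun i => xor (x i) (w i)) = a) = true then (1 : ℝ) else 0) *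
    parityVec z (fun i => xor (x i) (w i)) = _
  rw [hammingDist_xor, parityVec_xor]
  split_ifs with h h' h' <;> simp_all [mul_comm]

lemma parityVec_ne_zero {n : ℕ} (z : Bits n) : parityVec z ≠ 0 := fun h => by
  have := parityVec_mul_self z z
  simp [h] at this

lemma hasEigenvector_parityVec {n : ℕ} (a : ℕ) (z : Bits n) :
    Module.End.HasEigenvector (toLin' (commMatrix (hamEq n a)))
      (krawtchouk a n (ones z) : ℝ) (parityVec z) :=
  ⟨Module.End.mem_eigenspace_iff.2 (by rw [toLin'_apply, commMatrix_mulVec_parityVec]),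
    parityVec_ne_zero z⟩

lemma commMatrix_hamEq_transpose (n a : ℕ) :
    (commMatrix (hamEq n a))ᵀ = commMatrix (hamEq n a) := by
  ext x y
  simp [commMatrix, hamEq, hammingDist_comm]

lemma exists_ones_eq {n m : ℕ} (h : m ≤ n) : ∃ z : Bits n, ones z = m := by
  obtain ⟨s, -, hs⟩ := Finset.exists_subset_card_eq (s := (Finset.univ : Finset (Fin n))) (n := m)
    (by simpa using h)
  exact ⟨fun i => decide (i ∈ s), by simpa [ones] using hs⟩

lemma hasEigenvalue_commMatrix_iff (n a : ℕ) (μ : ℝ) :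
    Module.End.HasEigenvalue (toLin' (commMatrix (hamEq n a))) μ ↔
      ∃ m : ℕ, m ≤ n ∧ μ = (krawtchouk a n m : ℝ) := by
  constructor
  · intro h
    obtain ⟨v, hv, hv0⟩ := h.exists_hasEigenvector
    rw [Module.End.mem_eigenspace_iff, toLin'_apply] at hv
    -- Completeness: by `∑ z, χ_z(x) χ_z(y) = 2^n δ_xy`, a vector orthogonal to every character is
    -- zero.
    obtain ⟨z, hz⟩ : ∃ z, parityVec z ⬝ᵥ v ≠ 0 := by
      by_contra! hall
      refine hv0 (funext fun x => ?_)
      have h0 : ∑ z : Bits n, parityVec z x * (parityVec z ⬝ᵥ v) = 0 := by simp [hall]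
      simp only [dotProduct, Finset.mul_sum] at h0
      rw [Finset.sum_comm] at h0
      simp only [← mul_assoc, ← Finset.sum_mul, parityVec_comm _ x] at h0
      simp only [fun y z : Bits n => parityVec_comm z y] at h0
      simp only [sum_parityVec_mul, ite_mul, zero_mul, Finset.sum_ite_eq, Finset.mem_univ,
        if_true] at h0
      simpa using h0
    refine ⟨ones z, ones_le z, ?_⟩
    -- Symmetry of `M` lets it act on the character instead, so `μ` equals that character's
    -- eigenvalue.
    have h1 : parityVec z ⬝ᵥ (commMatrix (hamEq n a) *ᵥ v) = μ * (parityVec z ⬝ᵥ v) := by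
      rw [hv, dotProduct_smul, smul_eq_mul]
    rw [dotProduct_mulVec, ← mulVec_transpose, commMatrix_hamEq_transpose,
      commMatrix_mulVec_parityVec, smul_dotProduct, smul_eq_mul] at h1
    exact (mul_right_cancel₀ hz h1).symm
  · rintro ⟨m, hm, rfl⟩
    obtain ⟨z, rfl⟩ := exists_ones_eq hm
    exact Module.End.hasEigenvalue_of_hasEigenvector (hasEigenvector_parityVec a z)

/-! ### Counting the vanishing eigenvalues -/

lemma card_krawtchouk_zeros_le {n a : ℕ} (ha : a ≤ n) :
    ((Finset.range (n + 1)).filter fun m => krawtchouk a n m = 0).card ≤ a := by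
  -- Each binomial is a falling factorial over a factorial, so the `k`-th term has degree at most `k
  -- + (a - k) = a` in `m`.
  let p : ℚ[X] := ∑ k ∈ Finset.range (a + 1),
    C ((-1 : ℚ) ^ k / (k.factorial * (a - k).factorial)) *
      (descPochhammer ℚ k * (descPochhammer ℚ (a - k)).comp (C (n : ℚ) - X))
  have heval {m : ℕ} (hm : m ≤ n) : p.eval (m : ℚ) = (krawtchouk a n m : ℚ) := by
    rw [krawtchouk_eq_sum_range hm, eval_finsetSum]
    push_cast
    refine Finset.sum_congr rfl fun k _ => ?_
    rw [eval_mul, eval_mul, eval_comp, eval_sub, eval_C, eval_C, eval_X, ← Nat.cast_sub hm,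
      descPochhammer_eval_eq_descFactorial, descPochhammer_eval_eq_descFactorial,
      Nat.descFactorial_eq_factorial_mul_choose, Nat.descFactorial_eq_factorial_mul_choose]
    push_cast
    have := Nat.factorial_ne_zero k
    have := Nat.factorial_ne_zero (a - k)
    field_simp
  have hdeg : p.natDegree ≤ a := by
    refine natDegree_sum_le_of_forall_le _ _ fun k hk => ?_
    refine (natDegree_C_mul_le _ _).trans (natDegree_mul_le.trans ?_)
    have h1 : (C (n : ℚ) - X).natDegree ≤ 1 := (natDegree_sub_le _ _).trans (by simp)
    have h2 := Nat.mul_le_mul_left (a - k) h1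
    rw [natDegree_comp, descPochhammer_natDegree, descPochhammer_natDegree]
    rw [Finset.mem_range] at hk
    omega
  -- The value at `0` is `n.choose a`, positive because `a ≤ n`.
  have hp : p ≠ 0 := fun h0 => by
    have h := heval (Nat.zero_le n)
    rw [h0, krawtchouk] at h
    have h' : a - n = 0 := by omega
    simp only [eval_zero, h', add_zero, min_zero, Finset.Icc_self, Finset.sum_singleton,
      Nat.choose_self, Nat.cast_one, tsub_zero, one_mul, pow_zero, mul_one, Int.cast_natCast] at h
    exact (Nat.choose_pos ha).ne' (by exact_mod_cast h.symm)
  refine le_trans ?_ hdeg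
  rw [← Finset.card_image_of_injective _ (Nat.cast_injective (R := ℚ))]
  refine card_le_degree_of_subset_roots fun q hq => ?_
  rw [Finset.mem_val, Finset.mem_image] at hq
  obtain ⟨m, hm, rfl⟩ := hq
  rw [Finset.mem_filter, Finset.mem_range] at hm
  rw [mem_roots hp, IsRoot, heval (by omega), hm.2, Int.cast_zero]

/-- Induction: the ratio of consecutive left sides is at most `16`, since `(2k + 1)(2k + 3) ≤ 4(k +
1)^2`. -/
lemma centralBinom_sq_mul_le (k : ℕ) : k.centralBinom ^ 2 * (2 * k + 1) ≤ 16 ^ k := by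
  induction k with
  | zero => simp
  | succ k ih =>
    have h := Nat.succ_mul_centralBinom_succ k
    have hk : 0 < (k + 1) ^ 2 := by positivity
    refine Nat.le_of_mul_le_mul_left ?_ hk
    calc (k + 1) ^ 2 * ((k + 1).centralBinom ^ 2 * (2 * (k + 1) + 1))
        = ((k + 1) * (k + 1).centralBinom) ^ 2 * (2 * k + 3) := by ring
      _ = 4 * ((2 * k + 1) * (2 * k + 3)) * (k.centralBinom ^ 2 * (2 * k + 1)) := by rw [h]; ring
      _ ≤ 4 * (4 * (k + 1) ^ 2) * 16 ^ k :=
        Nat.mul_le_mul (Nat.mul_le_mul_left _ (by nlinarith)) ih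
      _ = (k + 1) ^ 2 * 16 ^ (k + 1) := by ring

lemma choose_half_sq_mul_le (n : ℕ) : n.choose (n / 2) ^ 2 * (n + 1) ≤ 4 ^ n := by
  obtain ⟨k, rfl | rfl⟩ := n.even_or_odd'
  · have h := centralBinom_sq_mul_le k
    rw [Nat.centralBinom_eq_two_mul_choose] at h
    rw [Nat.mul_div_cancel_left k (by norm_num), pow_mul]
    exact h
  · have h := centralBinom_sq_mul_le (k + 1)
    -- The middle coefficient of an odd row is half the next central one, which reduces to the even
    -- case.
    have hc : (k + 1).centralBinom = 2 * (2 * k + 1).choose k := by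
      rw [Nat.centralBinom_eq_two_mul_choose, show 2 * (k + 1) = (2 * k + 1) + 1 by ring,
        Nat.choose_succ_succ, Nat.choose_symm_half]
      ring
    rw [hc] at h
    rw [show (2 * k + 1) / 2 = k by omega, show 4 ^ (2 * k + 1) = 4 * 16 ^ k by
      rw [pow_succ, pow_mul]; ring]
    rw [pow_succ 16] at h
    nlinarith [Nat.zero_le ((2 * k + 1).choose k ^ 2)]

lemma krawtchouk_zero_right {a n : ℕ} (ha : a ≤ n) : krawtchouk a n 0 = n.choose a := by
  simp [krawtchouk, Nat.sub_eq_zero_of_le ha]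

/-- The character sum at `z = 0`, where every summand of weight `m` is `1`. -/
lemma card_ones_eq {n m : ℕ} (hm : m ≤ n) :
    (Finset.univ.filter fun z : Bits n => ones z = m).card = n.choose m := by
  have h := sum_parityVec_ones m (fun _ => false : Bits n)
  have h0 : ones (fun _ => false : Bits n) = 0 := by simp [ones]
  rw [h0, krawtchouk_zero_right hm] at h
  rw [Finset.card_filter]
  have h1 (w : Bits n) : parityVec (fun _ => false) w = 1 := by simp [parityVec]
  simp only [h1] at h
  exact_mod_cast h

lemma card_krawtchouk_ones_zero_le {n a : ℕ} (ha : a ≤ n) :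
    (Finset.univ.filter fun z : Bits n => krawtchouk a n (ones z) = 0).card ≤
      n.choose (n / 2) * a := by
  refine (Finset.card_le_mul_card_image_of_maps_to (f := ones)
    (t := (Finset.range (n + 1)).filter fun m => krawtchouk a n m = 0) (fun z hz => ?_)
    (n.choose (n / 2)) fun m hm => ?_).trans
    (Nat.mul_le_mul_left _ (card_krawtchouk_zeros_le ha))
  · simp only [Finset.mem_filter, Finset.mem_univ, true_and] at hz
    simp [hz, Nat.lt_succ_of_le (ones_le z)]
  · rw [Finset.mem_filter, Finset.mem_range] at hm
    refine (Finset.card_le_card fun z hz => ?_).trans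
      ((card_ones_eq (Nat.le_of_lt_succ hm.1)).le.trans (Nat.choose_le_middle m n))
    rw [Finset.mem_filter] at hz
    simp [hz.2]

/-- More than half of the eigenvalues of the matrix of `HAM_n^(=a)`, counted with multiplicity, are
nonzero if `a ≤ √n / 4`. -/
lemma two_pow_lt_two_mul_card {n a : ℕ} (h : 16 * a ^ 2 ≤ n) :
    2 ^ n < 2 * Fintype.card {z : Bits n // krawtchouk a n (ones z) ≠ 0} := by
  have ha : a ≤ n := by nlinarith [Nat.zero_le a]
  have h1 := card_krawtchouk_ones_zero_le ha
  have h2 := choose_half_sq_mul_le n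
  have h3 : 2 * (n.choose (n / 2) * a) < 2 ^ n := by
    -- After squaring and multiplying by `n + 1`, only `4 * a ^ 2 < n + 1` is needed.
    refine lt_of_pow_lt_pow_left₀ 2 (by positivity) ?_
    have h4 : (2 ^ n) ^ 2 = 4 ^ n := by rw [← pow_mul, mul_comm, pow_mul]; norm_num
    rw [h4]
    have h5 : 0 < 4 ^ n := by positivity
    have h6 : (2 * (n.choose (n / 2) * a)) ^ 2 * (n + 1) < 4 ^ n * (n + 1) := by
      calc (2 * (n.choose (n / 2) * a)) ^ 2 * (n + 1)
          = (n.choose (n / 2) ^ 2 * (n + 1)) * (4 * a ^ 2) := by ring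
        _ ≤ 4 ^ n * (4 * a ^ 2) := Nat.mul_le_mul_right _ h2
        _ < 4 ^ n * (n + 1) := Nat.mul_lt_mul_of_pos_left (by omega) h5
    exact lt_of_mul_lt_mul_right h6 (Nat.zero_le _)
  have h4 : Fintype.card {z : Bits n // krawtchouk a n (ones z) ≠ 0} +
      (Finset.univ.filter fun z : Bits n => krawtchouk a n (ones z) = 0).card = 2 ^ n := by
    rw [Fintype.card_subtype, add_comm]
    have := Finset.card_filter_add_card_filter_not (s := (Finset.univ : Finset (Bits n)))
      (fun z => krawtchouk a n (ones z) = 0)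
    simpa using this
  omega

/-! ### The lower bounds -/

/-- Supplies the diagonalization required by `card_le_of_sum_mul_eq`; the factor `2 ^ n` is the
squared norm of a character. -/
lemma sum_parityVec_mul_hamEq (n a : ℕ) (z z' : Bits n) :
    ∑ x, ∑ y, (parityVec z x : ℂ) * parityVec z' y * (if hamEq n a x y then 1 else 0) =
      if z = z' then ((krawtchouk a n (ones z) * 2 ^ n : ℝ) : ℂ) else 0 := by
  have h : ∑ x, ∑ y, parityVec z x * parityVec z' y * (if hamEq n a x y then 1 else 0) =
      if z = z' then (krawtchouk a n (ones z) * 2 ^ n : ℝ) else 0 := by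
    calc ∑ x, ∑ y, parityVec z x * parityVec z' y * (if hamEq n a x y then 1 else 0)
        = parityVec z ⬝ᵥ (commMatrix (hamEq n a) *ᵥ parityVec z') := by
          simp only [dotProduct, mulVec, Finset.mul_sum]
          refine Finset.sum_congr rfl fun x _ => Finset.sum_congr rfl fun y _ => ?_
          rw [commMatrix, of_apply]
          ring
      _ = _ := by
          rw [commMatrix_mulVec_parityVec, dotProduct_smul, dotProduct, sum_parityVec_mul]
          split_ifs with hz <;> simp [hz]
  have := congrArg (fun t : ℝ => (t : ℂ)) h
  push_cast at this ⊢
  simpa [apply_ite] using this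

/-- A decomposition of the matrix of `HAM_n^(=a)` into `2 ^ c` products needs `c ≥ n`. -/
lemma le_of_hamEq_decomposition {n a c d : ℕ} (h : 16 * a ^ 2 ≤ n) (hd : 0 < d) {R : Type}
    [Fintype R] (hR : Fintype.card R ≤ 2 ^ c) {A B : R → Bits n → Matrix (Fin d) (Fin d) ℂ}
    (hAB : ∀ x y, ∑ r, A r x * B r y = if hamEq n a x y then 1 else 0) : n ≤ c := by
  have hle : Fintype.card {z : Bits n // krawtchouk a n (ones z) ≠ 0} ≤ Fintype.card R :=
    card_le_of_sum_mul_eq hd (A := A) (B := B) (M := fun x y : Bits n => if hamEq n a x y then 1 else 0)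
      (u := fun z x => (parityVec z.1 x : ℂ)) (w := fun z x => (parityVec z.1 x : ℂ))
      (μ := fun z => ((krawtchouk a n (ones z.1) * 2 ^ n : ℝ) : ℂ))
      (fun x y => by rw [hAB]; split_ifs <;> simp)
      (fun z => by simpa using z.2)
      (fun z z' => by simp only [sum_parityVec_mul_hamEq, Subtype.ext_iff])
  have hlt := two_pow_lt_two_mul_card h
  -- More than half of `2 ^ n` gives `n < c + 1`; as `c` is an integer, nothing is lost.
  have : 2 ^ n < 2 ^ (c + 1) := by rw [pow_succ]; omega
  exact Nat.le_of_lt_succ ((Nat.pow_lt_pow_iff_right (by norm_num)).1 this)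

lemma le_D_hamEq {n a : ℕ} (h : 16 * a ^ 2 ≤ n) : (n : ℕ∞) ≤ D (hamEq n a) := by
  refine le_iInf₂ fun P hP => ?_
  obtain ⟨R, _, A, B, hR, hAB⟩ := P.exists_sum_mul
  have := le_of_hamEq_decomposition h one_pos hR
    (A := fun r x => A r x • (1 : Matrix (Fin 1) (Fin 1) ℂ)) (B := fun r y => B r y • 1)
    fun x y => by
      simp only [smul_mul_smul_comm, mul_one, ← Finset.sum_smul, hAB, hP x y]
      cases hamEq n a x y <;> simp
  exact_mod_cast this

lemma le_Cstar_hamEq {n a : ℕ} (h : 16 * a ^ 2 ≤ n) : (n : ℕ∞) ≤ Cstar (hamEq n a) := by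
  refine le_iInf fun k => le_iInf₂ fun P hP => ?_
  obtain ⟨R, _, A, B, hR, hpr⟩ := P.exists_localSum true
  exact_mod_cast le_of_hamEq_decomposition h (by positivity) hR (B := fun r y => (B r y)ᵀ)
    (sum_mul_transpose_of_exact (pr := P.prob) hpr P.prob_nonneg P.prob_add_le hP)

/-- The `2 ^ (2 * cost)` terms give `n ≤ 2 * cost`; `(n + 1) / 2` is `n / 2` rounded up. -/
lemma le_Qstar_hamEq {n a : ℕ} (h : 16 * a ^ 2 ≤ n) :
    (((n + 1) / 2 : ℕ) : ℕ∞) ≤ Qstar (hamEq n a) := by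
  refine le_iInf fun k => le_iInf₂ fun P hP => ?_
  obtain ⟨R, _, A, B, hR, hpr⟩ := P.exists_localSum true
  have := le_of_hamEq_decomposition h (by positivity) hR (B := fun r y => (B r y)ᵀ)
    (sum_mul_transpose_of_exact (pr := P.prob) hpr P.prob_nonneg P.prob_add_le hP)
  exact_mod_cast (by omega : (n + 1) / 2 ≤ P.cost)

lemma half_le_Qstar_hamEq {n a : ℕ} (h : 16 * a ^ 2 ≤ n) :
    (n : ℝ≥0∞) / 2 ≤ (Qstar (hamEq n a) : ℝ≥0∞) := by
  refine le_trans ?_ (ENat.toENNReal_le.2 (le_Qstar_hamEq h))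
  rw [ENat.toENNReal_coe]
  refine ENNReal.div_le_of_le_mul ?_
  exact_mod_cast (by omega : n ≤ (n + 1) / 2 * 2)

end HamComm

theorem theorem4p6 :
    (∃ c : ℝ, 0 < c ∧ ∀ n a : ℕ, (a : ℝ) ≤ c * Real.sqrt n →
      (n : ℕ∞) ≤ HamComm.D (HamComm.hamEq n a) ∧
      (n : ℝ≥0∞) / 2 ≤ (HamComm.Qstar (HamComm.hamEq n a) : ℝ≥0∞) ∧
      (n : ℕ∞) ≤ HamComm.Cstar (HamComm.hamEq n a)) ∧
    (∀ n a : ℕ, a ≤ n →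
      (∀ z : HamComm.Bits n,
        Module.End.HasEigenvector (Matrix.toLin' (HamComm.commMatrix (HamComm.hamEq n a)))
          (HamComm.krawtchouk a n (HamComm.ones z) : ℝ) (HamComm.parityVec z)) ∧
      (∀ μ : ℝ,
        Module.End.HasEigenvalue (Matrix.toLin' (HamComm.commMatrix (HamComm.hamEq n a))) μ ↔
          ∃ m : ℕ, m ≤ n ∧ μ = (HamComm.krawtchouk a n m : ℝ)) ∧
      ((Finset.range (n + 1)).filter fun m => HamComm.krawtchouk a n m = 0).card ≤ a) := by
  -- With constant `1 / 4`, squaring the hypothesis yields `16 * a ^ 2 ≤ n`.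
  refine ⟨⟨1 / 4, by norm_num, fun n a h => ?_⟩, fun n a ha =>
    ⟨HamComm.hasEigenvector_parityVec a, HamComm.hasEigenvalue_commMatrix_iff n a,
      HamComm.card_krawtchouk_zeros_le ha⟩⟩
  have h' : 16 * a ^ 2 ≤ n := by
    have h1 := Real.sq_sqrt (Nat.cast_nonneg (α := ℝ) n)
    have h2 : (16 * a ^ 2 : ℝ) ≤ n := by
      nlinarith [Real.sqrt_nonneg (n : ℝ), Nat.cast_nonneg (α := ℝ) a]
    exact_mod_cast h2
  exact ⟨HamComm.le_D_hamEq h', HamComm.half_le_Qstar_hamEq h', HamComm.le_Cstar_hamEq h'⟩
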